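/- Let $(W_t)_{t\in[0,1]}$ be a real-valued standard Wiener process and let $h:[0,\infty)\to[0,\infty)$ be a function with $h(t)>0$ for $t>0$ such that $t\mapsto h(t)$ is (not necessarily strictly) increasing on $[0,\infty)$ and $t\mapsto h(t)/\sqrt t$ is (not necessarily strictly) decreasing on $(0,\infty)$. For $s>0$ put $$\phi(s):=\int_{0+}^s \frac{h(t)}{t^{3/2}}\,e^{-\frac{h^2(t)}{2t}}\,dt\in[0,\infty],$$ and assume $\lim_{s\to0+}\phi(s)<\infty$. Then $$\mathbb P\big(\exists\,\delta>0:\ W_t/h(t)<1 \text{ for all } t\in(0,\delta)\big)=1.$$ Moreover, let $(b_n)_{n\ge1}$ be a positive sequence with $b_n\searrow0$ and let $(a_n)_{n\ge1}$ be a positive sequence. For $N\in\{0,1,2,\dots\}\cup\{\infty\}$ put $\mathcal S_a(N):=\sum_{1\le n\le N}a_n$, with $\mathcal S_a(0)=0$, and let $$\mathcal O:=\sum_{n=1}^\infty \mathbf 1\Big\{\sup_{t\in(0,b_n)}\frac{W_t}{h(t)}>1\Big\}$$ (here and below, $t$ ranges over $(0,b_n)\cap[0,1]$). Then $$\mathbb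 E[\mathcal S_a(\mathcal O)]=\sum_{n=1}^\infty a_n\,\mathbb P\Big(\sup_{t\in(0,b_n)}\frac{W_t}{h(t)}>1\Big)\qquad\text{and}\qquad \mathbb E[\mathcal S_a(\mathcal O)]\le\sum_{n=1}^\infty a_n\,\phi(b_n),$$ and for all integers $k\ge1$ $$\mathbb P(\mathcal O\ge k)\le \mathcal S_a(k)^{-1}\sum_{n=1}^\infty a_n\,\phi(b_n),\qquad \mathbb P\Big(\#\Big\{n\ge1:\ \exists\,t\in(0,b_n),\ \frac{W_t}{h(t)}\ge1\Big\}\ge k\Big)\le \mathcal S_a(k)^{-1}\sum_{n=1}^\infty a_n\,\phi(b_n).$$ (The inequalities are informative when $\sum_n a_n\phi(b_n)<\infty$.) -/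

import Mathlib

open MeasureTheory ProbabilityTheory Filter Topology
open scoped ENNReal NNReal unitInterval

noncomputable section

/-- `W` is a real-valued standard Wiener process on the time interval `I = [0, 1]`: it starts at
`0`, has independent increments, the increment over `[s, t]` is `N(0, t - s)`-distributed, and
almost all paths are continuous. -/
structure IsWienerProcess {Ω : Type*} [MeasurableSpace Ω] (W : I → Ω → ℝ) (P : Measure Ω) :
    Prop where
  zero : ∀ᵐ ω ∂P, W 0 ω = 0
  indep : HasIndepIncrements W P
  law : ∀ s t : I, s ≤ t →
    HasLaw (fun ω => W t ω - W s ω) (gaussianReal 0 (Real.toNNReal ((t : ℝ) - s))) P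
  cont : ∀ᵐ ω ∂P, Continuous fun t : I => W t ω

/-- The Kolmogorov integral `φ(s) = ∫_{0+}^s h(t) t^{-3/2} exp (-h(t)² / (2t)) dt ∈ [0, ∞]`. -/
def kolmogorovIntegral (h : ℝ → ℝ) (s : ℝ) : ℝ≥0∞ :=
  ∫⁻ t in Set.Ioc 0 s, ENNReal.ofReal (h t / t ^ (3 / 2 : ℝ) * Real.exp (-(h t) ^ 2 / (2 * t)))

/-- `sup_{t ∈ (0, b)} W_t(ω) / h(t)`, an element of the extended real line. -/
def supRatio {Ω : Type*} (W : I → Ω → ℝ) (h : ℝ → ℝ) (b : ℝ) (ω : Ω) : EReal :=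
  ⨆ t : I, ⨆ _ : 0 < (t : ℝ) ∧ (t : ℝ) < b, ((W t ω / h t : ℝ) : EReal)

/-- The deviation frequency: the number (possibly `∞`) of indices `n` with
`sup_{t ∈ (0, b_n)} W_t / h(t) > 1`. -/
def deviationCount {Ω : Type*} (W : I → Ω → ℝ) (h : ℝ → ℝ) (b : ℕ → ℝ) (ω : Ω) : ℕ∞ :=
  {n : ℕ | 1 < supRatio W h (b n) ω}.encard

/-- The number (possibly `∞`) of indices `n` for which the ratio `W_t / h(t)` attains a value
`≥ 1` at some time `t ∈ (0, b_n)`. -/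
def hitCount {Ω : Type*} (W : I → Ω → ℝ) (h : ℝ → ℝ) (b : ℕ → ℝ) (ω : Ω) : ℕ∞ :=
  {n : ℕ | ∃ t : I, (0 < (t : ℝ) ∧ (t : ℝ) < b n) ∧ 1 ≤ W t ω / h t}.encard

open Classical in
/-- The discrete antiderivative `S_a(N)`: the sum of the first `N` terms of the sequence `a`, with
`S_a(0) = 0` and `S_a(∞)` the sum of the whole series. Sequences are indexed from `0` here, so the
`n`-th term of a sequence indexed from `1` is the value at `n - 1`. -/
def antiderivSum (a : ℕ → ℝ≥0) (N : ℕ∞) : ℝ≥0∞ :=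
  ∑' n : ℕ, if (n : ℕ∞) < N then (a n : ℝ≥0∞) else 0

theorem antiderivSum_natCast (a : ℕ → ℝ≥0) (N : ℕ) :
    antiderivSum a N = ∑ n ∈ Finset.range N, (a n : ℝ≥0∞) := by
  classical
  unfold antiderivSum
  rw [tsum_eq_sum (s := Finset.range N)]
  · exact Finset.sum_congr rfl fun n hn => by simp [Finset.mem_range.1 hn]
  · intro n hn
    have : ¬ n < N := by simpa using hn
    simp [this]

end

/-!
The heart of the matter is the bound `P (W_t ≥ h t for some t ∈ (0, b)) ≤ φ(b)`, proved in
`IsWienerProcess.measure_exists_one_le_div_le`; everything else is bookkeeping.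

By the reflection principle, the first passage time of a level `x > 0` has distribution function
`2 P (W_t > x)`, hence density `x t^{-3/2} exp (-x² / (2t)) / √(2π)`. On a grid `a = t₀ < ⋯ < t_N`,
a path which reaches the increasing curve `h` during `[a, t_N]` either reaches the level `h a`
before time `a`, or reaches for some `i` the level `h (t_i)` for the first time during
`(t_i, t_{i+1}]`. If the grid is fine, the first passage densities of the frozen levels `h (t_i)`
are comparable to the Kolmogorov integrand; the factor `1 / √(2π) < 1`, absent from `φ`, leaves
room for the discretization, so that no passage to the limit is needed
(`IsWienerProcess.measure_exists_ge_Icc_le`). Finally `a → 0`: finiteness of `φ` forces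
`h a / √a → ∞`, since otherwise the integrand would dominate a multiple of `1 / t`, and so the
probability `2 P (W_a > h a)` of reaching the level `h a` before time `a` tends to `0`.

The reflection principle (`IsWienerProcess.measure_exists_gt`) is obtained from finite grids. Given
that the sampled path first exceeds `x` at a grid point, the later increment is independent and
symmetric; this yields Lévy's inequality `P (max > x) ≤ 2 P (W_t > x)`, and a converse with an
overshoot `ε`, up to the probability that some increment exceeds `ε`, which vanishes as the mesh
tends to `0` by the Gaussian tail bound.

For the moment identities, the events `{sup_{t < b_n} W_t / h(t) > 1}` decrease in `n`, so that
`n` is below the deviation count exactly when the `n`-th event occurs. Hence `S_a` of the count is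
a sum of indicators weighted by `a_n`, and the tail bounds are Markov's inequality.
-/

/-! ### Centred Gaussian laws on the line -/

lemma gaussianReal_Iio_neg (v : ℝ≥0) (x : ℝ) :
    gaussianReal 0 v (Set.Iio (-x)) = gaussianReal 0 v (Set.Ioi x) := by
  have h := gaussianReal_map_neg (μ := 0) (v := v)
  rw [neg_zero] at h
  rw [← h, Measure.map_apply measurable_neg measurableSet_Iio, h]
  congr 1
  ext y
  simp

lemma gaussianReal_Ioi_zero_le (v : ℝ≥0) : gaussianReal 0 v (Set.Ioi 0) ≤ 1 / 2 := by
  have h := gaussianReal_Iio_neg v 0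
  rw [neg_zero] at h
  have h1 : gaussianReal 0 v (Set.Ioi 0) + gaussianReal 0 v (Set.Ioi 0) ≤ 1 := by
    nth_rewrite 1 [← h]
    rw [← measure_union _ measurableSet_Ioi]
    · exact prob_le_one
    · exact Set.disjoint_left.2 fun y (hy : y < 0) (hy' : 0 < y) => lt_asymm hy hy'
  rw [← two_mul, mul_comm] at h1
  exact (ENNReal.le_div_iff_mul_le (by simp) (by simp)).2 h1

lemma half_le_gaussianReal_Ici_zero (v : ℝ≥0) : 1 / 2 ≤ gaussianReal 0 v (Set.Ici 0) := by
  have h := gaussianReal_Iio_neg v 0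
  rw [neg_zero] at h
  have h1 : gaussianReal 0 v (Set.Ici 0) = 1 - gaussianReal 0 v (Set.Ioi 0) := by
    rw [← h, ← prob_compl_eq_one_sub measurableSet_Iio, Set.compl_Iio]
  rw [h1, one_div, ← ENNReal.one_sub_inv_two, ← one_div]
  exact tsub_le_tsub_left (gaussianReal_Ioi_zero_le v) 1

/-- Chernoff's bound. For `v = 0` the exponent is `0` by convention and the bound is trivial. -/
lemma gaussianReal_Ioi_le_exp (v : ℝ≥0) {ε : ℝ} (hε : 0 ≤ ε) :
    gaussianReal 0 v (Set.Ioi ε) ≤ ENNReal.ofReal (Real.exp (-ε ^ 2 / (2 * v))) := by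
  have hs : HasSubgaussianMGF id v (gaussianReal 0 v) :=
    { integrable_exp_mul := fun t => integrable_exp_mul_gaussianReal t
      mgf_le := fun t => by rw [mgf_id_gaussianReal]; simp }
  have h := hs.measure_ge_le hε
  rw [← ENNReal.ofReal_toReal (measure_ne_top (gaussianReal 0 v) (Set.Ioi ε))]
  refine ENNReal.ofReal_le_ofReal (le_trans ?_ h)
  exact measureReal_mono fun y (hy : ε < y) => le_of_lt hy

/-- Brownian scaling of the tail of a centred Gaussian law. -/
lemma gaussianReal_Ioi_scale {t : ℝ} (ht : 0 < t) (x : ℝ) :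
    gaussianReal 0 t.toNNReal (Set.Ioi x) = gaussianReal 0 1 (Set.Ioi (x / √t)) := by
  have h := gaussianReal_map_const_mul (μ := 0) (v := 1) (√t)
  have h2 : NNReal.mk (√t ^ 2) (sq_nonneg _) * 1 = t.toNNReal := by
    rw [mul_one]
    ext
    simp [Real.sq_sqrt ht.le, ht.le]
  rw [h2, mul_zero] at h
  rw [← h, Measure.map_apply (measurable_const_mul _) measurableSet_Ioi]
  congr 1
  ext y
  simp [div_lt_iff₀ (Real.sqrt_pos.2 ht), mul_comm]

namespace IsWienerProcess

variable {Ω : Type*} [MeasurableSpace Ω] {P : Measure Ω} {W : I → Ω → ℝ}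

lemma aemeasurable (hW : IsWienerProcess W P) (t : I) : AEMeasurable (W t) P := by
  refine (hW.law 0 t bot_le).aemeasurable.congr ?_
  filter_upwards [hW.zero] with ω hω
  simp [hω]

lemma measure_sub_preimage (hW : IsWienerProcess W P) {s t : I} (hst : s ≤ t) {B : Set ℝ}
    (hB : MeasurableSet B) :
    P {ω | W t ω - W s ω ∈ B} = gaussianReal 0 (Real.toNNReal ((t : ℝ) - s)) B := by
  have h := hW.law s t hst
  rw [← h.map_eq, Measure.map_apply_of_aemeasurable h.aemeasurable hB]
  rfl

lemma measure_gt (hW : IsWienerProcess W P) (t : I) (x : ℝ) :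
    P {ω | x < W t ω} = gaussianReal 0 (Real.toNNReal t) (Set.Ioi x) := by
  have h := hW.measure_sub_preimage (s := 0) (t := t) bot_le (measurableSet_Ioi (a := x))
  simp only [Set.Icc.coe_zero, sub_zero] at h
  rw [← h]
  refine measure_congr ?_
  filter_upwards [hW.zero] with ω hω
  change (x < W t ω) = (x < W t ω - W 0 ω)
  rw [hω, sub_zero]

end IsWienerProcess

/-! ### First exceedance and Lévy's inequality on a grid -/

/-- The event that `k` is the first index at which the sampled path `S` exceeds the level `x`. -/
def firstExceedance {Ω : Type*} (S : ℕ → Ω → ℝ) (x : ℝ) (k : ℕ) : Set Ω :=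
  {ω | x < S k ω ∧ ∀ j < k, S j ω ≤ x}

section FirstExceedance

variable {Ω : Type*} {S : ℕ → Ω → ℝ} {x : ℝ}

lemma firstExceedance_disjoint {i j : ℕ} (hij : i ≠ j) :
    Disjoint (firstExceedance S x i) (firstExceedance S x j) := by
  refine Set.disjoint_left.2 fun ω hi hj => ?_
  rcases lt_or_gt_of_ne hij with h | h
  · exact absurd (hj.2 i h) (not_le.2 hi.1)
  · exact absurd (hi.2 j h) (not_le.2 hj.1)

lemma exists_exceedance_eq (S : ℕ → Ω → ℝ) (x : ℝ) (N : ℕ) :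
    {ω | ∃ k ≤ N, x < S k ω} = ⋃ k ∈ Finset.range (N + 1), firstExceedance S x k := by
  classical
  ext ω
  simp only [Set.mem_ofPred_eq, Set.mem_iUnion, Finset.mem_range, exists_prop]
  constructor
  · rintro ⟨k, hk, hx⟩
    have hex : ∃ k, x < S k ω := ⟨k, hx⟩
    refine ⟨Nat.find hex, by have := Nat.find_min' hex hx; omega, Nat.find_spec hex, ?_⟩
    exact fun j hj => not_lt.1 (Nat.find_min hex hj)
  · rintro ⟨k, hk, hx⟩
    exact ⟨k, by omega, hx.1⟩

variable [MeasurableSpace Ω] {P : Measure Ω}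

lemma nullMeasurableSet_firstExceedance (hS : ∀ k, AEMeasurable (S k) P) (k : ℕ) :
    NullMeasurableSet (firstExceedance S x k) P := by
  have : firstExceedance S x k = {ω | x < S k ω} ∩ ⋂ j ∈ Finset.range k, {ω | S j ω ≤ x} := by
    ext ω; simp [firstExceedance]
  rw [this]
  refine NullMeasurableSet.inter (nullMeasurableSet_lt aemeasurable_const (hS k)) ?_
  exact Finset.nullMeasurableSet_biInter _ fun j _ => nullMeasurableSet_le (hS j) aemeasurable_const

lemma measure_exists_exceedance (hS : ∀ k, AEMeasurable (S k) P) (N : ℕ) :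
    P {ω | ∃ k ≤ N, x < S k ω} = ∑ k ∈ Finset.range (N + 1), P (firstExceedance S x k) := by
  rw [exists_exceedance_eq, measure_biUnion_finset₀]
  · exact fun i _ j _ hij => (firstExceedance_disjoint hij).aedisjoint
  · exact fun k _ => nullMeasurableSet_firstExceedance hS k

end FirstExceedance

namespace IsWienerProcess

variable {Ω : Type*} [MeasurableSpace Ω] {P : Measure Ω}
  {W : I → Ω → ℝ}

/-- The increment after a grid point is independent of the event that the sampled path first
exceeds `x` there. -/
lemma measure_firstExceedance_inter (hW : IsWienerProcess W P) {s : ℕ → I} (hs : Monotone s)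
    (hs0 : s 0 = 0) (x : ℝ) {k N : ℕ} (hk : k ≤ N) {B : Set ℝ} (hB : MeasurableSet B) :
    P (firstExceedance (fun j => W (s j)) x k ∩ {ω | W (s N) ω - W (s k) ω ∈ B})
      = P (firstExceedance (fun j => W (s j)) x k)
        * gaussianReal 0 (Real.toNNReal ((s N : ℝ) - s k)) B := by
  -- The time sequence `s 0, …, s k, s N, s N, …` makes `W (s N) - W (s k)` a single increment.
  let r : ℕ → I := fun j => if j ≤ k then s j else s N
  have hr : Monotone r := by
    intro i j hij
    simp only [r]
    split_ifs with h1 h2 h2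
    · exact hs hij
    · exact hs (h1.trans hk)
    · omega
    · exact le_rfl
  let X : ℕ → Ω → ℝ := fun i ω => W (r (i + 1)) ω - W (r i) ω
  have hX : iIndepFun X P := hW.indep.nat hr
  have hXm : ∀ i, AEMeasurable (X i) P := fun i => (hW.aemeasurable _).sub (hW.aemeasurable _)
  have hind := hX.indepFun_finset₀ (Finset.range k) {k} (by simp) hXm
  -- `W (s j)` is the sum of the first `j` increments, as `W 0 = 0`, so the first exceedance is
  -- determined by the increments of index below `k`.
  let A : Set (Finset.range k → ℝ) :=
    {y | x < ∑ i : Finset.range k, y i ∧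
      ∀ j < k, ∑ i : Finset.range k, (if (i : ℕ) < j then y i else 0) ≤ x}
  have hA : MeasurableSet A := by
    have : A = {y | x < ∑ i : Finset.range k, y i} ∩ ⋂ j ∈ Finset.range k,
        {y | ∑ i : Finset.range k, (if (i : ℕ) < j then y i else 0) ≤ x} := by
      ext y; simp [A]
    rw [this]
    refine (measurableSet_lt measurable_const (by fun_prop)).inter ?_
    refine Finset.measurableSet_biInter _ fun j _ => measurableSet_le ?_ measurable_const
    refine Finset.measurable_sum _ fun i _ => ?_
    split_ifs
    · fun_prop
    · exact measurable_const
  let C : Set (({k} : Finset ℕ) → ℝ) := {y | y ⟨k, by simp⟩ ∈ B}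
  have hC : MeasurableSet C := (measurable_pi_apply _) hB
  have hXk : ∀ ω, X k ω = W (s N) ω - W (s k) ω := fun ω => by simp [X, r]
  have hsum : ∀ᵐ ω ∂P, ∀ j ≤ k, ∑ i ∈ Finset.range j, X i ω = W (s j) ω := by
    filter_upwards [hW.zero] with ω hω j hj
    have : ∑ i ∈ Finset.range j, X i ω = W (r j) ω - W (r 0) ω :=
      Finset.sum_range_sub (fun i => W (r i) ω) j
    rw [this]
    simp [r, hj, hs0, hω]
  have hfst : firstExceedance (fun j => W (s j)) x k
      =ᵐ[P] (fun ω (i : Finset.range k) => X i ω) ⁻¹' A := by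
    filter_upwards [hsum] with ω hω
    refine propext ?_
    have h1 : ∀ j ≤ k, ∑ i : Finset.range k, (if (i : ℕ) < j then X i ω else 0) = W (s j) ω := by
      intro j hj
      rw [← hω j hj, Finset.sum_coe_sort (Finset.range k) (fun i => if i < j then X i ω else 0),
        ← Finset.sum_filter]
      congr 1
      ext i; simp; omega
    have h2 : ∑ i : Finset.range k, X i ω = W (s k) ω := by
      rw [← hω k le_rfl, Finset.sum_coe_sort (Finset.range k) (fun i => X i ω)]
    change (x < W (s k) ω ∧ ∀ j < k, W (s j) ω ≤ x) ↔ (x < ∑ i : Finset.range k, X i ω ∧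
      ∀ j < k, ∑ i : Finset.range k, (if (i : ℕ) < j then X i ω else 0) ≤ x)
    rw [h2]
    exact and_congr_right fun _ => forall₂_congr fun j hj => by rw [h1 j hj.le]
  have hsnd : {ω | W (s N) ω - W (s k) ω ∈ B}
      = (fun ω (i : ({k} : Finset ℕ)) => X i ω) ⁻¹' C := by
    ext ω
    simp only [C, Set.mem_preimage, Set.mem_ofPred_eq, hXk]
  have hinter : P (firstExceedance (fun j => W (s j)) x k ∩ {ω | W (s N) ω - W (s k) ω ∈ B})
      = P ((fun ω (i : Finset.range k) => X i ω) ⁻¹' A ∩ {ω | W (s N) ω - W (s k) ω ∈ B}) :=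
    measure_congr (ae_eq_set_inter hfst (ae_eq_refl _))
  rw [← hW.measure_sub_preimage (hs hk) hB, hinter, measure_congr hfst, hsnd,
    hind.measure_inter_preimage_eq_mul _ _ hA hC]

/-- **Lévy's inequality**: given that the level is first exceeded at some grid point, the path
ends above the level with probability at least one half. -/
lemma measure_exists_grid_gt_le (hW : IsWienerProcess W P) {s : ℕ → I} (hs : Monotone s)
    (hs0 : s 0 = 0) (x : ℝ) (N : ℕ) :
    P {ω | ∃ k ≤ N, x < W (s k) ω} ≤ 2 * P {ω | x < W (s N) ω} := by
  have hm : ∀ k, AEMeasurable (W (s k)) P := fun k => hW.aemeasurable _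
  rw [measure_exists_exceedance (S := fun j => W (s j)) hm]
  have h1 : ∑ k ∈ Finset.range (N + 1), P (firstExceedance (fun j => W (s j)) x k ∩
      {ω | W (s N) ω - W (s k) ω ∈ Set.Ici 0}) ≤ P {ω | x < W (s N) ω} := by
    rw [← measure_biUnion_finset₀]
    · refine measure_mono ?_
      simp only [Set.iUnion_subset_iff]
      rintro k - ω ⟨h, h'⟩
      have h1 := h.1
      simp only [Set.mem_ofPred_eq, Set.mem_Ici] at h' h1 ⊢
      linarith
    · exact fun i _ j _ hij => ((firstExceedance_disjoint hij).mono Set.inter_subset_left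
        Set.inter_subset_left).aedisjoint
    · intro k _
      exact (nullMeasurableSet_firstExceedance hm k).inter
        (((hm N).sub (hm k)).nullMeasurable measurableSet_Ici)
  calc ∑ k ∈ Finset.range (N + 1), P (firstExceedance (fun j => W (s j)) x k)
      ≤ ∑ k ∈ Finset.range (N + 1), 2 * P (firstExceedance (fun j => W (s j)) x k ∩
          {ω | W (s N) ω - W (s k) ω ∈ Set.Ici 0}) := by
        refine Finset.sum_le_sum fun k hk => ?_
        rw [hW.measure_firstExceedance_inter hs hs0 x (by simpa [Nat.lt_succ_iff] using hk)
          measurableSet_Ici, mul_left_comm]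
        have h2 : 1 ≤ 2 * gaussianReal 0 (Real.toNNReal ((s N : ℝ) - s k)) (Set.Ici 0) := by
          calc (1 : ℝ≥0∞) = 2 * (1 / 2) := by rw [one_div, ENNReal.mul_inv_cancel] <;> simp
            _ ≤ _ := by gcongr; exact half_le_gaussianReal_Ici_zero _
        exact le_mul_of_one_le_right' h2
    _ ≤ 2 * P {ω | x < W (s N) ω} := by rw [← Finset.mul_sum]; gcongr

/-- The converse of Lévy's inequality: if no increment exceeds `ε`, the path overshoots the level
by at most `ε` when first exceeding it, so a final value above `x + ε` needs a positive increment
afterwards, which has probability at most one half. -/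
lemma two_mul_measure_gt_add_le (hW : IsWienerProcess W P) {s : ℕ → I} (hs : Monotone s)
    (hs0 : s 0 = 0) {x ε : ℝ} (hx : 0 ≤ x) (hε : 0 ≤ ε) (N : ℕ) :
    2 * P {ω | x + ε < W (s N) ω} ≤ P {ω | ∃ k ≤ N, x < W (s k) ω}
      + 2 * ∑ k ∈ Finset.range N, P {ω | ε < W (s (k + 1)) ω - W (s k) ω} := by
  have hm : ∀ k, AEMeasurable (W (s k)) P := fun k => hW.aemeasurable _
  have hsub : ∀ᵐ ω ∂P, ω ∈ {ω | x + ε < W (s N) ω} →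
      ω ∈ (⋃ k ∈ Finset.range (N + 1), (firstExceedance (fun j => W (s j)) x k ∩
        {ω | W (s N) ω - W (s k) ω ∈ Set.Ioi 0})) ∪
        ⋃ k ∈ Finset.range N, {ω | ε < W (s (k + 1)) ω - W (s k) ω} := by
    filter_upwards [hW.zero] with ω hω0 hω
    by_cases hbad : ∃ k < N, ε < W (s (k + 1)) ω - W (s k) ω
    · right
      obtain ⟨k, hk, h⟩ := hbad
      simp only [Set.mem_iUnion, Finset.mem_range]
      exact ⟨k, hk, h⟩
    · left
      push Not at hbad
      have hex : ω ∈ {ω | ∃ k ≤ N, x < W (s k) ω} := ⟨N, le_rfl, by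
        have : x + ε < W (s N) ω := hω
        change x < W (s N) ω
        linarith⟩
      rw [exists_exceedance_eq (fun j => W (s j))] at hex
      simp only [Set.mem_iUnion, Finset.mem_range, exists_prop] at hex ⊢
      obtain ⟨k, hk, hfk⟩ := hex
      refine ⟨k, hk, hfk, ?_⟩
      have h1 : W (s k) ω ≤ x + ε := by
        rcases k with _ | k
        · rw [hs0, hω0]; exact add_nonneg hx hε
        · have := hbad k (by omega)
          have := hfk.2 k (by omega)
          linarith
      simp only [Set.mem_ofPred_eq, Set.mem_Ioi] at hω ⊢
      linarith
  have h1 : P {ω | x + ε < W (s N) ω} ≤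
      ∑ k ∈ Finset.range (N + 1), P (firstExceedance (fun j => W (s j)) x k) * (1 / 2)
        + ∑ k ∈ Finset.range N, P {ω | ε < W (s (k + 1)) ω - W (s k) ω} := by
    refine (measure_mono_ae hsub).trans ((measure_union_le _ _).trans (add_le_add ?_ ?_))
    · refine (measure_biUnion_finset_le _ _).trans (Finset.sum_le_sum fun k hk => ?_)
      rw [hW.measure_firstExceedance_inter hs hs0 x (by simpa [Nat.lt_succ_iff] using hk)
        measurableSet_Ioi]
      gcongr
      exact gaussianReal_Ioi_zero_le _
    · exact measure_biUnion_finset_le _ _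
  rw [measure_exists_exceedance (S := fun j => W (s j)) hm]
  calc 2 * P {ω | x + ε < W (s N) ω} ≤ 2 * (_ + _) := by gcongr
    _ = _ := by
      rw [mul_add, ← Finset.sum_mul, mul_left_comm, one_div,
        ENNReal.mul_inv_cancel (by simp) (by simp), mul_one]

end IsWienerProcess

/-! ### The reflection principle -/

/-- The grid `0, t/(N+1), 2t/(N+1), …, t` of `[0, t]`, continued after `t` up to the time `1`. -/
noncomputable def uniformGrid (t : I) (N k : ℕ) : I :=
  Set.projIcc 0 1 zero_le_one ((t : ℝ) * (k / (N + 1)))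

lemma uniformGrid_monotone (t : I) (N : ℕ) : Monotone (uniformGrid t N) := by
  intro i j hij
  refine Set.monotone_projIcc _ (mul_le_mul_of_nonneg_left ?_ t.2.1)
  gcongr

lemma uniformGrid_zero (t : I) (N : ℕ) : uniformGrid t N 0 = 0 := by
  simp [uniformGrid]

lemma coe_uniformGrid (t : I) {N k : ℕ} (hk : k ≤ N + 1) :
    (uniformGrid t N k : ℝ) = t * (k / (N + 1)) := by
  have h1 : (k : ℝ) / (N + 1) ≤ 1 := by
    rw [div_le_one (by positivity)]
    exact_mod_cast hk
  rw [uniformGrid, Set.projIcc_of_mem]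
  exact ⟨mul_nonneg t.2.1 (by positivity), mul_le_one₀ t.2.2 (by positivity) h1⟩

lemma uniformGrid_last (t : I) (N : ℕ) : uniformGrid t N (N + 1) = t := by
  ext
  rw [coe_uniformGrid t le_rfl]
  push_cast
  rw [div_self (by positivity), mul_one]

lemma coe_uniformGrid_succ_sub (t : I) {N k : ℕ} (hk : k < N + 1) :
    (uniformGrid t N (k + 1) : ℝ) - uniformGrid t N k = t / (N + 1) := by
  rw [coe_uniformGrid t hk, coe_uniformGrid t hk.le]
  push_cast
  ring

lemma exists_tendsto_uniformGrid {s t : I} (hst : s ≤ t) :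
    ∃ k : ℕ → ℕ, (∀ N, k N ≤ N + 1) ∧
      Tendsto (fun N => uniformGrid t N (k N)) atTop (𝓝 s) := by
  have hst' : (s : ℝ) ≤ t := hst
  have hu0 : (0 : ℝ) ≤ s / t := div_nonneg s.2.1 t.2.1
  have hu1 : (s : ℝ) / t ≤ 1 := div_le_one_of_le₀ hst' t.2.1
  have hs : (t : ℝ) * (s / t) = s := by
    rcases eq_or_ne (t : ℝ) 0 with h | h
    · rw [h, zero_mul]; linarith [s.2.1]
    · field_simp
  have hk : ∀ N : ℕ, ⌊(s / t : ℝ) * ((N : ℝ) + 1)⌋₊ ≤ N + 1 := by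
    intro N
    refine Nat.floor_le_of_le ?_
    push_cast
    exact mul_le_of_le_one_left (by positivity) hu1
  refine ⟨_, hk, ?_⟩
  rw [tendsto_subtype_rng]
  simp_rw [coe_uniformGrid t (hk _)]
  rw [← hs]
  refine Tendsto.const_mul _ ?_
  rw [hs]
  exact (tendsto_nat_floor_mul_div_atTop hu0).comp
    (tendsto_atTop_add_const_right _ 1 tendsto_natCast_atTop_atTop)

lemma gaussianReal_zero_Ici {v : ℝ≥0} (hv : v ≠ 0) (x : ℝ) :
    gaussianReal 0 v (Set.Ici x) = gaussianReal 0 v (Set.Ioi x) := by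
  have := nullSingletonClass_gaussianReal (μ := 0) hv
  exact (measure_congr Ioi_ae_eq_Ici).symm

lemma tendsto_gaussianReal_Ioi_add (v : ℝ≥0) (x : ℝ) :
    Tendsto (fun n : ℕ => gaussianReal 0 v (Set.Ioi (x + 1 / ((n : ℝ) + 1)))) atTop
      (𝓝 (gaussianReal 0 v (Set.Ioi x))) := by
  have hu : Set.Ioi x = ⋃ n : ℕ, Set.Ioi (x + 1 / ((n : ℝ) + 1)) := by
    ext y
    simp only [Set.mem_iUnion, Set.mem_Ioi]
    constructor
    · intro h
      obtain ⟨n, hn⟩ := exists_nat_one_div_lt (sub_pos.2 h)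
      exact ⟨n, by linarith⟩
    · rintro ⟨n, hn⟩
      have : 0 < 1 / ((n : ℝ) + 1) := by positivity
      linarith
  rw [hu]
  refine tendsto_measure_iUnion_atTop fun m n hmn => Set.Ioi_subset_Ioi ?_
  have := Nat.one_div_le_one_div (α := ℝ) hmn
  linarith

lemma tendsto_gaussianReal_Ioi_sub {v : ℝ≥0} (hv : v ≠ 0) (x : ℝ) :
    Tendsto (fun n : ℕ => gaussianReal 0 v (Set.Ioi (x - 1 / ((n : ℝ) + 1)))) atTop
      (𝓝 (gaussianReal 0 v (Set.Ioi x))) := by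
  have hu : Set.Ici x = ⋂ n : ℕ, Set.Ioi (x - 1 / ((n : ℝ) + 1)) := by
    ext y
    simp only [Set.mem_iInter, Set.mem_Ioi, Set.mem_Ici]
    constructor
    · intro h n
      have : 0 < 1 / ((n : ℝ) + 1) := by positivity
      linarith
    · intro h
      by_contra! hlt
      obtain ⟨n, hn⟩ := exists_nat_one_div_lt (sub_pos.2 hlt)
      linarith [h n]
  rw [← gaussianReal_zero_Ici hv, hu]
  refine tendsto_measure_iInter_atTop (fun n => measurableSet_Ioi.nullMeasurableSet) ?_
    ⟨0, measure_ne_top _ _⟩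
  intro m n hmn
  refine Set.Ioi_subset_Ioi ?_
  have := Nat.one_div_le_one_div (α := ℝ) hmn
  linarith

namespace IsWienerProcess

variable {Ω : Type*} [MeasurableSpace Ω] {P : Measure Ω} {W : I → Ω → ℝ}

/-- By path continuity, exceeding a continuous curve somewhere on a set of times is decided on a
countable dense subset. -/
lemma nullMeasurableSet_exists_gt (hW : IsWienerProcess W P) (J : Set I) {g : I → ℝ}
    (hg : ContinuousOn g J) : NullMeasurableSet {ω | ∃ s ∈ J, g s < W s ω} P := by
  obtain ⟨D, hDJ, hD, hJD⟩ := (TopologicalSpace.IsSeparable.of_separableSpace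
    J).exists_countable_dense_subset
  have h1 : NullMeasurableSet (⋃ s ∈ D, {ω | g s < W s ω}) P :=
    NullMeasurableSet.biUnion hD fun s _ =>
      nullMeasurableSet_lt aemeasurable_const (hW.aemeasurable s)
  refine h1.congr ?_
  filter_upwards [hW.cont] with ω hω
  refine propext ?_
  change ω ∈ (⋃ s ∈ D, {ω | g s < W s ω}) ↔ ∃ s ∈ J, g s < W s ω
  simp only [Set.mem_iUnion, Set.mem_ofPred_eq, exists_prop]
  refine ⟨fun ⟨s, hs, h⟩ => ⟨s, hDJ hs, h⟩, fun ⟨s, hs, h⟩ => ?_⟩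
  have h2 : ∀ᶠ r in 𝓝[J] s, g r < W r ω :=
    (hg s hs).eventually_lt hω.continuousAt.continuousWithinAt h
  have h3 : ∀ᶠ r in 𝓝[D] s, g r < W r ω := nhdsWithin_mono _ hDJ h2
  have : (𝓝[D] s).NeBot := mem_closure_iff_nhdsWithin_neBot.1 (hJD hs)
  obtain ⟨r, hr, hrD⟩ := (h3.and self_mem_nhdsWithin).exists
  exact ⟨r, hrD, hr⟩

lemma measure_exists_gt_le (hW : IsWienerProcess W P) (t : I) (x : ℝ) :
    P {ω | ∃ s ≤ t, x < W s ω} ≤ 2 * gaussianReal 0 (Real.toNNReal t) (Set.Ioi x) := by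
  -- A continuous path exceeding `x` does so on all sufficiently fine grids, which exhausts the
  -- event by the increasing sequence `E`.
  let E : ℕ → Set Ω := fun m => {ω | ∀ N ≥ m, ∃ k ≤ N + 1, x < W (uniformGrid t N k) ω}
  have hE : Monotone E := fun m n hmn ω hω N hN => hω N (hmn.trans hN)
  have hPE : ∀ m, P (E m) ≤ 2 * gaussianReal 0 (Real.toNNReal t) (Set.Ioi x) := by
    intro m
    rw [← hW.measure_gt]
    have h := hW.measure_exists_grid_gt_le (uniformGrid_monotone t m) (uniformGrid_zero t m) x
      (m + 1)
    rw [uniformGrid_last] at h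
    refine (measure_mono ?_).trans h
    intro ω hω
    exact hω m le_rfl
  have hsub : ∀ᵐ ω ∂P, ω ∈ {ω | ∃ s ≤ t, x < W s ω} → ω ∈ ⋃ m, E m := by
    filter_upwards [hW.cont] with ω hω
    rintro ⟨s, hs, hx⟩
    obtain ⟨k, hk, hlim⟩ := exists_tendsto_uniformGrid hs
    have h2 : ∀ᶠ N in atTop, x < W (uniformGrid t N (k N)) ω :=
      ((hω.tendsto s).comp hlim).eventually_const_lt hx
    obtain ⟨m, hm⟩ := eventually_atTop.1 h2
    exact Set.mem_iUnion.2 ⟨m, fun N hN => ⟨k N, hk N, hm N hN⟩⟩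
  refine (measure_mono_ae (t := ⋃ m, E m) hsub).trans ?_
  rw [hE.measure_iUnion]
  exact iSup_le hPE

lemma measure_exists_ge_le (hW : IsWienerProcess W P) {t : I} (ht : 0 < t) (x : ℝ) :
    P {ω | ∃ s ≤ t, x ≤ W s ω} ≤ 2 * gaussianReal 0 (Real.toNNReal t) (Set.Ioi x) := by
  have hv : Real.toNNReal t ≠ 0 := (Real.toNNReal_pos.2 ht).ne'
  refine ge_of_tendsto' (ENNReal.Tendsto.const_mul (tendsto_gaussianReal_Ioi_sub hv x)
    (Or.inr (by simp))) fun n => ?_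
  refine (measure_mono ?_).trans (hW.measure_exists_gt_le t _)
  rintro ω ⟨s, hs, hx⟩
  have : 0 < 1 / ((n : ℝ) + 1) := by positivity
  exact ⟨s, hs, by linarith⟩

/-- As the mesh tends to `0`, the probability of an increment above `ε` vanishes, being at most
`N exp (-ε² N / (2t))` for `N` grid intervals. -/
lemma two_mul_gaussianReal_add_le_measure_exists_gt (hW : IsWienerProcess W P) {t : I}
    (ht : 0 < t) {x ε : ℝ} (hx : 0 ≤ x) (hε : 0 < ε) :
    2 * gaussianReal 0 (Real.toNNReal t) (Set.Ioi (x + ε)) ≤ P {ω | ∃ s ≤ t, x < W s ω} := by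
  have ht' : (0 : ℝ) < t := ht
  let c : ℝ := ε ^ 2 / (2 * t)
  have hc : 0 < c := by positivity
  have hbd : ∀ N : ℕ, 2 * gaussianReal 0 (Real.toNNReal t) (Set.Ioi (x + ε))
      ≤ P {ω | ∃ s ≤ t, x < W s ω}
        + 2 * ENNReal.ofReal (((N + 1 : ℕ) : ℝ) * Real.exp (-c * ((N + 1 : ℕ) : ℝ))) := by
    intro N
    have h := hW.two_mul_measure_gt_add_le (uniformGrid_monotone t N) (uniformGrid_zero t N) hx
      hε.le (N + 1)
    rw [uniformGrid_last, hW.measure_gt] at h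
    refine h.trans (add_le_add (measure_mono ?_) ?_)
    · rintro ω ⟨k, hk, hω⟩
      exact ⟨uniformGrid t N k, (uniformGrid_monotone t N hk).trans (uniformGrid_last t N).le, hω⟩
    · have hterm : ∀ k ∈ Finset.range (N + 1),
          P {ω | ε < W (uniformGrid t N (k + 1)) ω - W (uniformGrid t N k) ω}
            ≤ ENNReal.ofReal (Real.exp (-c * ((N + 1 : ℕ) : ℝ))) := by
        intro k hk
        have h1 := hW.measure_sub_preimage (uniformGrid_monotone t N (Nat.le_succ k))
          (measurableSet_Ioi (a := ε))
        rw [Nat.succ_eq_add_one, coe_uniformGrid_succ_sub t (Finset.mem_range.1 hk)] at h1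
        refine (le_of_eq h1).trans ((gaussianReal_Ioi_le_exp _ hε.le).trans (le_of_eq ?_))
        rw [Real.coe_toNNReal _ (by positivity)]
        congr 2
        simp only [c]
        push_cast
        field_simp
      have h3 := Finset.sum_le_sum hterm
      rw [Finset.sum_const, Finset.card_range, nsmul_eq_mul] at h3
      rw [ENNReal.ofReal_mul (by positivity), ENNReal.ofReal_natCast]
      gcongr
  have hlim : Tendsto (fun N : ℕ => ((N + 1 : ℕ) : ℝ) * Real.exp (-c * ((N + 1 : ℕ) : ℝ))) atTop
      (𝓝 0) := by
    have h1 := (tendsto_rpow_mul_exp_neg_mul_atTop_nhds_zero 1 c hc).comp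
      (tendsto_natCast_atTop_atTop.comp (tendsto_add_atTop_nat 1))
    refine h1.congr fun N => ?_
    simp [Function.comp]
  have hlim2 : Tendsto (fun N : ℕ => P {ω | ∃ s ≤ t, x < W s ω}
        + 2 * ENNReal.ofReal (((N + 1 : ℕ) : ℝ) * Real.exp (-c * ((N + 1 : ℕ) : ℝ)))) atTop
      (𝓝 (P {ω | ∃ s ≤ t, x < W s ω} + 2 * ENNReal.ofReal 0)) :=
    tendsto_const_nhds.add
      (ENNReal.Tendsto.const_mul (ENNReal.tendsto_ofReal hlim) (Or.inr (by simp)))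
  simpa using ge_of_tendsto' hlim2 hbd

/-- The **reflection principle** for the running maximum of a Wiener process. -/
theorem measure_exists_gt (hW : IsWienerProcess W P) {t : I} (ht : 0 < t) {x : ℝ} (hx : 0 ≤ x) :
    P {ω | ∃ s ≤ t, x < W s ω} = 2 * gaussianReal 0 (Real.toNNReal t) (Set.Ioi x) := by
  refine le_antisymm (hW.measure_exists_gt_le t x) ?_
  refine le_of_tendsto' (ENNReal.Tendsto.const_mul (tendsto_gaussianReal_Ioi_add _ x)
    (Or.inr (by simp))) fun n => ?_
  exact hW.two_mul_gaussianReal_add_le_measure_exists_gt ht hx (by positivity)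

/-- An upper bound for the probability that the level `x` is first reached during `(s, t]`. -/
lemma measure_exists_ge_diff_le [IsFiniteMeasure P] (hW : IsWienerProcess W P) {s t : I}
    (hs : 0 < s) (hst : s ≤ t) {x : ℝ} (hx : 0 ≤ x) :
    P ({ω | ∃ r ≤ t, x ≤ W r ω} \ {ω | ∃ r ≤ s, x ≤ W r ω})
      ≤ 2 * gaussianReal 0 1 (Set.Ioc (x / √t) (x / √s)) := by
  have hs' : (0 : ℝ) < s := hs
  have hst' : (s : ℝ) ≤ t := hst
  have hnull : NullMeasurableSet {ω | ∃ r ≤ s, x < W r ω} P :=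
    hW.nullMeasurableSet_exists_gt (Set.Iic s) continuousOn_const
  have hle : x / √t ≤ x / √s := by gcongr
  have hIoc : Set.Ioc (x / √t) (x / √s) = Set.Ioi (x / √t) \ Set.Ioi (x / √s) := by
    ext y; simp
  -- Only the event with the strict inequality is known to be null measurable beforehand.
  calc P ({ω | ∃ r ≤ t, x ≤ W r ω} \ {ω | ∃ r ≤ s, x ≤ W r ω})
      ≤ P ({ω | ∃ r ≤ t, x ≤ W r ω} \ {ω | ∃ r ≤ s, x < W r ω}) := by
        refine measure_mono (Set.sdiff_subset_sdiff_right ?_)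
        exact fun ω ⟨r, hr, h⟩ => ⟨r, hr, h.le⟩
    _ = P {ω | ∃ r ≤ t, x ≤ W r ω} - P {ω | ∃ r ≤ s, x < W r ω} := by
        refine measure_sdiff ?_ hnull (measure_ne_top _ _)
        exact fun ω ⟨r, hr, h⟩ => ⟨r, hr.trans hst, h.le⟩
    _ ≤ 2 * gaussianReal 0 1 (Set.Ioi (x / √t)) - 2 * gaussianReal 0 1 (Set.Ioi (x / √s)) := by
        rw [hW.measure_exists_gt hs hx, gaussianReal_Ioi_scale hs',
          ← gaussianReal_Ioi_scale (hs'.trans_le hst')]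
        gcongr
        exact hW.measure_exists_ge_le (hs.trans_le hst) x
    _ = 2 * gaussianReal 0 1 (Set.Ioc (x / √t) (x / √s)) := by
        rw [hIoc, measure_sdiff (Set.Ioi_subset_Ioi hle) measurableSet_Ioi.nullMeasurableSet
          (measure_ne_top _ _), ENNReal.mul_sub (by simp)]

end IsWienerProcess

/-! ### The probability of reaching an increasing curve -/

lemma rpow_three_halves {t : ℝ} (ht : 0 ≤ t) : t ^ (3 / 2 : ℝ) = t * √t := by
  rw [show (3 / 2 : ℝ) = 1 + 1 / 2 by norm_num, Real.rpow_add' ht (by norm_num), Real.rpow_one,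
    Real.sqrt_eq_rpow]

lemma exp_quarter_le : Real.exp (1 / 4) ≤ 4 / 3 := by
  refine le_of_pow_le_pow_left₀ (n := 4) (by norm_num) (by norm_num) ?_
  rw [← Real.exp_nat_mul]
  have := Real.exp_one_lt_d9
  norm_num at this ⊢
  linarith

/-- Over a short interval `[s, t]`, the mass which the first passage law of the level `x` gives
to it is at most its length times a lower bound of the Kolmogorov integrand. The missing factor
`1 / √(2π)` in that integrand pays for the discretization. -/
lemma two_mul_pdf_mul_le {s t x : ℝ} (hs : 0 < s) (hst : s ≤ t) (hx : 0 ≤ x)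
    (h1 : t ≤ 5 / 4 * s) (h2 : x ^ 2 / (2 * s) - x ^ 2 / (2 * t) ≤ 1 / 4) :
    2 * ((√(2 * Real.pi))⁻¹ * Real.exp (-x ^ 2 / (2 * t)) * (x / √s - x / √t))
      ≤ x / (t * √t) * Real.exp (-x ^ 2 / (2 * s)) * (t - s) := by
  have ht : 0 < t := hs.trans_le hst
  have hpi : 2 ≤ √(2 * Real.pi) := by
    rw [Real.le_sqrt' (by norm_num)]
    linarith [Real.pi_gt_three]
  have hexp : Real.exp (-x ^ 2 / (2 * t)) ≤ 4 / 3 * Real.exp (-x ^ 2 / (2 * s)) := by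
    have : Real.exp (-x ^ 2 / (2 * t))
        = Real.exp (x ^ 2 / (2 * s) - x ^ 2 / (2 * t)) * Real.exp (-x ^ 2 / (2 * s)) := by
      rw [← Real.exp_add]; congr 1; ring
    rw [this]
    gcongr
    exact (Real.exp_le_exp.2 h2).trans exp_quarter_le
  obtain ⟨p, hp, hps⟩ : ∃ p : ℝ, 0 < p ∧ s = p ^ 2 := ⟨√s, Real.sqrt_pos.2 hs, by
    rw [Real.sq_sqrt hs.le]⟩
  obtain ⟨q, hq, hqt⟩ : ∃ q : ℝ, 0 < q ∧ t = q ^ 2 := ⟨√t, Real.sqrt_pos.2 ht, by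
    rw [Real.sq_sqrt ht.le]⟩
  have hsp : √s = p := by rw [hps, Real.sqrt_sq hp.le]
  have htq : √t = q := by rw [hqt, Real.sqrt_sq hq.le]
  have hpq : p ≤ q := by rw [← hsp, ← htq]; exact Real.sqrt_le_sqrt hst
  have hpq2 : q ^ 2 ≤ 5 / 4 * p ^ 2 := by rw [← hps, ← hqt]; exact h1
  have hdiff : 0 ≤ x / √s - x / √t := by
    rw [hsp, htq, sub_nonneg]; gcongr
  have hkey : 4 / 3 * (x / √s - x / √t) ≤ x / (t * √t) * (t - s) := by
    rw [hsp, htq, hps, hqt]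
    have e1 : x / p - x / q = x * (q - p) / (p * q) := by field_simp
    have e2 : x / (q ^ 2 * q) * (q ^ 2 - p ^ 2)
        = x * (q - p) / (p * q) * (p * (q + p) / q ^ 2) := by field_simp; ring
    rw [e1, e2, mul_comm]
    refine mul_le_mul_of_nonneg_left ?_
      (div_nonneg (mul_nonneg hx (sub_nonneg.2 hpq)) (by positivity))
    rw [le_div_iff₀ (by positivity)]
    nlinarith
  calc 2 * ((√(2 * Real.pi))⁻¹ * Real.exp (-x ^ 2 / (2 * t)) * (x / √s - x / √t))
      ≤ 2 * ((2 : ℝ)⁻¹ * (4 / 3 * Real.exp (-x ^ 2 / (2 * s))) * (x / √s - x / √t)) := by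
        gcongr
    _ = Real.exp (-x ^ 2 / (2 * s)) * (4 / 3 * (x / √s - x / √t)) := by ring
    _ ≤ Real.exp (-x ^ 2 / (2 * s)) * (x / (t * √t) * (t - s)) := by gcongr
    _ = _ := by ring

lemma gaussianReal_Ioc_le {y z : ℝ} (hy : 0 ≤ y) :
    gaussianReal 0 1 (Set.Ioc y z)
      ≤ ENNReal.ofReal ((√(2 * Real.pi))⁻¹ * Real.exp (-y ^ 2 / 2) * (z - y)) := by
  rw [gaussianReal_apply 0 one_ne_zero]
  calc ∫⁻ u in Set.Ioc y z, gaussianPDF 0 1 u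
      ≤ ∫⁻ _ in Set.Ioc y z, ENNReal.ofReal ((√(2 * Real.pi))⁻¹ * Real.exp (-y ^ 2 / 2)) := by
        refine setLIntegral_mono measurable_const fun u hu => ENNReal.ofReal_le_ofReal ?_
        simp only [gaussianPDFReal, NNReal.coe_one, mul_one, sub_zero]
        have := hu.1.le
        gcongr
    _ = _ := by
        rw [setLIntegral_const, Real.volume_Ioc, ENNReal.ofReal_mul (p := _ * _) (by positivity)]

section Curve

variable {h : ℝ → ℝ}

/-- The integrand of the Kolmogorov integral. -/
noncomputable def kolmogorovIntegrand (h : ℝ → ℝ) (t : ℝ) : ℝ :=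
  h t / t ^ (3 / 2 : ℝ) * Real.exp (-(h t) ^ 2 / (2 * t))

lemma antitoneOn_sq_div (h_pos : ∀ t, 0 < t → 0 < h t)
    (h_anti : AntitoneOn (fun t => h t / √t) (Set.Ioi 0)) :
    AntitoneOn (fun t => h t ^ 2 / (2 * t)) (Set.Ioi 0) := by
  intro s (hs : 0 < s) t (ht : 0 < t) hst
  have h1 : h t / √t ≤ h s / √s := h_anti hs ht hst
  have h0 : 0 ≤ h t / √t := div_nonneg (h_pos t ht).le (Real.sqrt_nonneg _)
  have h2 : (h t / √t) ^ 2 ≤ (h s / √s) ^ 2 := by gcongr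
  rw [div_pow, div_pow, Real.sq_sqrt hs.le, Real.sq_sqrt ht.le] at h2
  simp only [mul_comm (2 : ℝ), ← div_div]
  gcongr

lemma two_mul_gaussianReal_Ioc_le_lintegral (h_pos : ∀ t, 0 < t → 0 < h t)
    (h_mono : MonotoneOn h (Set.Ici 0))
    (h_anti : AntitoneOn (fun t => h t / √t) (Set.Ioi 0)) {s t : ℝ} (hs : 0 < s) (hst : s ≤ t)
    (h1 : t ≤ 5 / 4 * s) (h2 : h s ^ 2 / (2 * s) - h s ^ 2 / (2 * t) ≤ 1 / 4) :
    2 * gaussianReal 0 1 (Set.Ioc (h s / √t) (h s / √s))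
      ≤ ∫⁻ u in Set.Ioc s t, ENNReal.ofReal (kolmogorovIntegrand h u) := by
  have ht : 0 < t := hs.trans_le hst
  have hx : 0 ≤ h s := (h_pos s hs).le
  calc 2 * gaussianReal 0 1 (Set.Ioc (h s / √t) (h s / √s))
      ≤ ENNReal.ofReal (2 * ((√(2 * Real.pi))⁻¹ * Real.exp (-(h s) ^ 2 / (2 * t))
          * (h s / √s - h s / √t))) := by
        rw [ENNReal.ofReal_mul (by norm_num), ENNReal.ofReal_ofNat]
        gcongr
        refine (gaussianReal_Ioc_le (by positivity)).trans (le_of_eq ?_)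
        rw [div_pow, Real.sq_sqrt ht.le]
        congr 4
        field_simp
    _ ≤ ENNReal.ofReal (h s / (t * √t) * Real.exp (-(h s) ^ 2 / (2 * s)) * (t - s)) :=
        ENNReal.ofReal_le_ofReal (two_mul_pdf_mul_le hs hst hx h1 h2)
    _ = ∫⁻ _ in Set.Ioc s t,
          ENNReal.ofReal (h s / (t * √t) * Real.exp (-(h s) ^ 2 / (2 * s))) := by
        rw [setLIntegral_const, Real.volume_Ioc, ENNReal.ofReal_mul (p := _ * _) (by positivity)]
    _ ≤ ∫⁻ u in Set.Ioc s t, ENNReal.ofReal (kolmogorovIntegrand h u) := by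
        refine setLIntegral_mono' measurableSet_Ioc fun u hu => ENNReal.ofReal_le_ofReal ?_
        have hu0 : 0 < u := hs.trans hu.1
        have hu2 := hu.2
        have h3 : h s ≤ h u := h_mono hs.le hu0.le hu.1.le
        have h4 : h u ^ 2 / (2 * u) ≤ h s ^ 2 / (2 * s) :=
          antitoneOn_sq_div h_pos h_anti hs hu0 hu.1.le
        rw [kolmogorovIntegrand, rpow_three_halves hu0.le, neg_div, neg_div]
        have := h_pos u hu0
        gcongr

end Curve

namespace IsWienerProcess

variable {Ω : Type*} [MeasurableSpace Ω] {P : Measure Ω} {W : I → Ω → ℝ} {h : ℝ → ℝ}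

/-- The probability of reaching an increasing curve during `[a, b]` is at most that of reaching
its initial level before time `a`, plus the first passage densities integrated along the curve. -/
lemma measure_exists_ge_Icc_le [IsFiniteMeasure P] (hW : IsWienerProcess W P)
    (h_pos : ∀ t, 0 < t → 0 < h t) (h_mono : MonotoneOn h (Set.Ici 0))
    (h_anti : AntitoneOn (fun t => h t / √t) (Set.Ioi 0)) {a b : I} (ha : 0 < a) (hab : a ≤ b) :
    P {ω | ∃ t : I, a ≤ t ∧ t ≤ b ∧ h t ≤ W t ω}
      ≤ 2 * gaussianReal 0 1 (Set.Ioi (h a / √a))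
        + ∫⁻ u in Set.Ioc (a : ℝ) b, ENNReal.ofReal (kolmogorovIntegrand h u) := by
  have ha' : (0 : ℝ) < a := ha
  have hab' : (a : ℝ) ≤ b := hab
  have hb' : (0 : ℝ) < b := ha'.trans_le hab'
  have hH : 0 < h b := h_pos b hb'
  -- A mesh so fine that the estimate over short intervals applies on each interval of the grid.
  obtain ⟨N, hN⟩ := exists_nat_gt (max (4 / (a : ℝ)) (2 * h b ^ 2 / a ^ 2))
  have hN1 : 4 / (a : ℝ) < N := (le_max_left _ _).trans_lt hN
  have hN2 : 2 * h b ^ 2 / (a : ℝ) ^ 2 < N := (le_max_right _ _).trans_lt hN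
  have hN0 : (0 : ℝ) < N := lt_trans (by positivity) hN1
  have hmem : ∀ i : ℕ, a + min ((i : ℝ) / N) 1 * (b - a) ∈ I := by
    intro i
    have h0 : 0 ≤ min ((i : ℝ) / N) 1 := by positivity
    have h1 : min ((i : ℝ) / N) 1 ≤ 1 := min_le_right _ _
    have := b.2.2
    constructor <;> nlinarith
  let τ : ℕ → I := fun i => ⟨a + min ((i : ℝ) / N) 1 * (b - a), hmem i⟩
  have hτ0 : τ 0 = a := by ext; simp [τ]
  have hτN : τ N = b := by ext; simp [τ, div_self hN0.ne']
  have hτm : Monotone τ := by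
    intro i j hij
    have : min ((i : ℝ) / N) 1 ≤ min ((j : ℝ) / N) 1 := by gcongr
    exact Subtype.mk_le_mk.2 (by nlinarith)
  have hτs : ∀ i, (τ (i + 1) : ℝ) - τ i ≤ 1 / N := by
    intro i
    have h1 : min (((i + 1 : ℕ) : ℝ) / N) 1 ≤ min ((i : ℝ) / N) 1 + 1 / N := by
      have : ((i + 1 : ℕ) : ℝ) / N = i / N + 1 / N := by push_cast; ring
      rw [this]
      rcases min_cases ((i : ℝ) / N) 1 with ⟨e, -⟩ | ⟨e, -⟩ <;> rw [e]
      · exact min_le_left _ _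
      · exact (min_le_right _ _).trans (by simp)
    have h2 : (0 : ℝ) ≤ b - a := by linarith
    have h3 : (b : ℝ) - a ≤ 1 := by linarith [b.2.2]
    have h4 : (0 : ℝ) ≤ 1 / N := by positivity
    simp only [τ]
    nlinarith
  have hτa : ∀ i, (a : ℝ) ≤ τ i := fun i => by
    have : τ 0 ≤ τ i := hτm (Nat.zero_le i)
    rwa [hτ0] at this
  have hτb : ∀ i, (τ i : ℝ) ≤ b := fun i => by
    have h1 : min ((i : ℝ) / N) 1 ≤ 1 := min_le_right _ _
    simp only [τ]
    nlinarith
  -- Either the curve has been reached up to the time `τ i`, or its level at `τ i` has been; the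
  -- second event makes the sequence grow only by first passages through frozen levels.
  let B : ℕ → Set Ω := fun i => {ω | ∃ t : I, a ≤ t ∧ t ≤ τ i ∧ h t ≤ W t ω} ∪
    {ω | ∃ r ≤ τ i, h (τ i) ≤ W r ω}
  have hstep : ∀ i, B (i + 1) ⊆ B i ∪
      ({ω | ∃ r ≤ τ (i + 1), h (τ i) ≤ W r ω} \ {ω | ∃ r ≤ τ i, h (τ i) ≤ W r ω}) := by
    intro i ω hω
    have hlev : ω ∈ {ω | ∃ r ≤ τ (i + 1), h (τ i) ≤ W r ω} → ω ∈ B i ∪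
        ({ω | ∃ r ≤ τ (i + 1), h (τ i) ≤ W r ω} \ {ω | ∃ r ≤ τ i, h (τ i) ≤ W r ω}) := by
      intro h1
      by_cases h2 : ω ∈ {ω | ∃ r ≤ τ i, h (τ i) ≤ W r ω}
      · exact Or.inl (Or.inr h2)
      · exact Or.inr ⟨h1, h2⟩
    rcases hω with ⟨t, hat, htτ, hWt⟩ | ⟨r, hr, hWr⟩
    · rcases le_total t (τ i) with hti | hti
      · exact Or.inl (Or.inl ⟨t, hat, hti, hWt⟩)
      · exact hlev ⟨t, htτ, (h_mono (τ i).2.1 t.2.1 hti).trans hWt⟩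
    · exact hlev ⟨r, hr, (h_mono (τ i).2.1 (τ (i + 1)).2.1 (hτm (Nat.le_succ i))).trans hWr⟩
  have hmain : ∀ i, P (B i) ≤ 2 * gaussianReal 0 1 (Set.Ioi (h a / √a))
      + ∫⁻ u in Set.Ioc (a : ℝ) (τ i), ENNReal.ofReal (kolmogorovIntegrand h u) := by
    intro i
    induction i with
    | zero =>
      rw [hτ0, Set.Ioc_self, Measure.restrict_empty, lintegral_zero_measure, add_zero,
        ← gaussianReal_Ioi_scale ha']
      refine (measure_mono ?_).trans (hW.measure_exists_ge_le ha (h a))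
      rintro ω (⟨t, hat, htτ, hWt⟩ | ⟨r, hr, hWr⟩)
      · rw [hτ0] at htτ
        obtain rfl := le_antisymm hat htτ
        exact ⟨_, le_rfl, hWt⟩
      · rw [hτ0] at hr hWr
        exact ⟨r, hr, hWr⟩
    | succ i ih =>
      have hτi : (0 : ℝ) < τ i := ha'.trans_le (hτa i)
      have hle : (τ i : ℝ) ≤ τ (i + 1) := hτm (Nat.le_succ i)
      have hd := hτs i
      have hxb : h (τ i) ≤ h b := h_mono (τ i).2.1 b.2.1 (hτb i)
      have c1 : (τ (i + 1) : ℝ) ≤ 5 / 4 * τ i := by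
        have : 1 / (N : ℝ) ≤ a / 4 := by
          rw [div_le_iff₀ hN0]
          rw [div_lt_iff₀ ha'] at hN1
          linarith
        linarith [hτa i]
      have c2 : h (τ i) ^ 2 / (2 * τ i) - h (τ i) ^ 2 / (2 * τ (i + 1)) ≤ 1 / 4 := by
        have hτi1 : (0 : ℝ) < τ (i + 1) := hτi.trans_le hle
        have e : h (τ i) ^ 2 / (2 * τ i) - h (τ i) ^ 2 / (2 * τ (i + 1))
            = h (τ i) ^ 2 * ((τ (i + 1) : ℝ) - τ i) / (2 * (τ i * τ (i + 1))) := by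
          field_simp
        have hpos := h_pos _ hτi
        rw [e]
        calc h (τ i) ^ 2 * ((τ (i + 1) : ℝ) - τ i) / (2 * (τ i * τ (i + 1)))
            ≤ h b ^ 2 * (1 / N) / (2 * (a * a)) := by
              have := hτa i
              have := hτa (i + 1)
              gcongr
          _ ≤ 1 / 4 := by
              rw [div_lt_iff₀ (by positivity)] at hN2
              rw [mul_one_div, div_div, div_le_iff₀ (by positivity)]
              nlinarith
      have hinc := (hW.measure_exists_ge_diff_le (s := τ i) hτi hle (h_pos _ hτi).le).trans
        (two_mul_gaussianReal_Ioc_le_lintegral h_pos h_mono h_anti hτi hle c1 c2)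
      have hsplit : ∫⁻ u in Set.Ioc (a : ℝ) (τ (i + 1)), ENNReal.ofReal (kolmogorovIntegrand h u)
          = (∫⁻ u in Set.Ioc (a : ℝ) (τ i), ENNReal.ofReal (kolmogorovIntegrand h u))
            + ∫⁻ u in Set.Ioc (τ i : ℝ) (τ (i + 1)), ENNReal.ofReal (kolmogorovIntegrand h u) := by
        rw [← Set.Ioc_union_Ioc_eq_Ioc (hτa i) hle,
          lintegral_union measurableSet_Ioc (Set.Ioc_disjoint_Ioc_of_le le_rfl)]
      rw [hsplit, ← add_assoc]
      exact (measure_mono (hstep i)).trans ((measure_union_le _ _).trans (add_le_add ih hinc))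
  have hN' := hmain N
  rw [hτN] at hN'
  refine (measure_mono ?_).trans hN'
  exact fun ω ⟨t, hat, htb, hWt⟩ => Or.inl ⟨t, hat, htb.trans hτN.ge, hWt⟩

end IsWienerProcess

/-! ### Behaviour of the curve and of its Kolmogorov integral at zero -/

section Curve

variable {h : ℝ → ℝ}

/-- Squeezed between the monotonicity of `h` and that of `h t / √t`, the curve is continuous. -/
lemma continuousAt_of_monotoneOn_of_antitoneOn (h_mono : MonotoneOn h (Set.Ici 0))
    (h_anti : AntitoneOn (fun t => h t / √t) (Set.Ioi 0)) {t : ℝ} (ht : 0 < t) :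
    ContinuousAt h t := by
  have hst : 0 < √t := Real.sqrt_pos.2 ht
  have hlim : Tendsto (fun s => h t / √t * √s) (𝓝 t) (𝓝 (h t)) := by
    have h1 : Tendsto (fun s => h t / √t * √s) (𝓝 t) (𝓝 (h t / √t * √t)) :=
      (Real.continuous_sqrt.tendsto t).const_mul _
    rwa [div_mul_cancel₀ _ hst.ne'] at h1
  have hmin : Tendsto (fun s => min (h t) (h t / √t * √s)) (𝓝 t) (𝓝 (h t)) := by
    simpa using (tendsto_const_nhds (x := h t)).min hlim
  have hmax : Tendsto (fun s => max (h t) (h t / √t * √s)) (𝓝 t) (𝓝 (h t)) := by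
    simpa using (tendsto_const_nhds (x := h t)).max hlim
  refine tendsto_of_tendsto_of_tendsto_of_le_of_le' hmin hmax ?_ ?_
  · filter_upwards [lt_mem_nhds ht] with s hs
    rcases le_total s t with hle | hle
    · have h1 : h t / √t ≤ h s / √s := h_anti hs ht hle
      exact (min_le_right _ _).trans ((le_div_iff₀ (Real.sqrt_pos.2 hs)).1 h1)
    · exact (min_le_left _ _).trans (h_mono ht.le hs.le hle)
  · filter_upwards [lt_mem_nhds ht] with s hs
    rcases le_total s t with hle | hle
    · exact (h_mono hs.le ht.le hle).trans (le_max_left _ _)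
    · have h1 : h s / √s ≤ h t / √t := h_anti ht hs hle
      exact ((div_le_iff₀ (Real.sqrt_pos.2 hs)).1 h1).trans (le_max_right _ _)

lemma kolmogorovIntegrand_eq {t : ℝ} (ht : 0 < t) :
    kolmogorovIntegrand h t = (h t / √t) * Real.exp (-(h t / √t) ^ 2 / 2) * t⁻¹ := by
  rw [kolmogorovIntegrand, rpow_three_halves ht.le, div_pow, Real.sq_sqrt ht.le,
    show -(h t ^ 2 / t) / 2 = -(h t) ^ 2 / (2 * t) by field_simp]
  have := Real.sqrt_pos.2 ht
  field_simp

/-- If `h t / √t` were bounded near `0`, the Kolmogorov integrand would dominate a multiple of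
`1 / t` and its integral would diverge. -/
lemma tendsto_div_sqrt_atTop (h_pos : ∀ t, 0 < t → 0 < h t)
    (h_anti : AntitoneOn (fun t => h t / √t) (Set.Ioi 0)) {b : ℝ} (hb : 0 < b)
    (hfin : kolmogorovIntegral h b < ∞) :
    Tendsto (fun t => h t / √t) (𝓝[>] 0) atTop := by
  have hq : ∀ t, 0 < t → 0 < h t / √t := fun t ht => div_pos (h_pos t ht) (Real.sqrt_pos.2 ht)
  rw [tendsto_atTop]
  intro C
  suffices hex : ∃ s, 0 < s ∧ C ≤ h s / √s by
    obtain ⟨s, hs, hC⟩ := hex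
    filter_upwards [Ioc_mem_nhdsGT hs] with t ht
    exact hC.trans (h_anti ht.1 hs ht.2)
  by_contra! hlt
  let K : ℝ := h b / √b * Real.exp (-C ^ 2 / 2)
  have hK : 0 < K := mul_pos (hq b hb) (Real.exp_pos _)
  have hle : ∫⁻ t in Set.Ioc 0 b, ENNReal.ofReal (K * t⁻¹) ≤ kolmogorovIntegral h b := by
    refine setLIntegral_mono' measurableSet_Ioc fun t ht => ENNReal.ofReal_le_ofReal ?_
    have e := kolmogorovIntegrand_eq (h := h) ht.1
    rw [kolmogorovIntegrand] at e
    rw [e]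
    have h0 := hq t ht.1
    have h1 : h b / √b ≤ h t / √t := h_anti ht.1 hb ht.2
    have h2 := (hlt t ht.1).le
    have ht0 : (0 : ℝ) ≤ t⁻¹ := inv_nonneg.2 ht.1.le
    simp only [K]
    gcongr
  have hint : IntegrableOn (fun t : ℝ => K * t⁻¹) (Set.Ioc 0 b) := by
    refine ⟨by fun_prop, ?_⟩
    rw [hasFiniteIntegral_iff_ofReal]
    · exact hle.trans_lt hfin
    · filter_upwards [ae_restrict_mem measurableSet_Ioc] with t ht
      exact mul_nonneg hK.le (inv_nonneg.2 ht.1.le)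
  have hint2 : IntervalIntegrable (fun t : ℝ => t⁻¹) volume 0 b := by
    rw [intervalIntegrable_iff_integrableOn_Ioc_of_le hb.le]
    refine (hint.const_mul K⁻¹).congr (ae_of_all _ fun t => ?_)
    simp only
    rw [← mul_assoc, inv_mul_cancel₀ hK.ne', one_mul]
  rw [intervalIntegrable_inv_iff] at hint2
  rcases hint2 with h0 | h0
  · exact hb.ne h0
  · exact h0 Set.left_mem_uIcc

lemma tendsto_gaussianReal_div_sqrt (h_pos : ∀ t, 0 < t → 0 < h t)
    (h_anti : AntitoneOn (fun t => h t / √t) (Set.Ioi 0)) {b : ℝ} (hb : 0 < b)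
    (hfin : kolmogorovIntegral h b < ∞) :
    Tendsto (fun t => gaussianReal 0 1 (Set.Ioi (h t / √t))) (𝓝[>] 0) (𝓝 0) := by
  have hexp : Tendsto (fun y : ℝ => ENNReal.ofReal (Real.exp (-y ^ 2 / (2 * (1 : ℝ≥0)))))
      atTop (𝓝 0) := by
    rw [← ENNReal.ofReal_zero]
    refine ENNReal.tendsto_ofReal (Real.tendsto_exp_atBot.comp ?_)
    simp only [neg_div]
    exact tendsto_neg_atTop_atBot.comp
      ((tendsto_pow_atTop two_ne_zero).atTop_div_const (by norm_num))
  refine tendsto_of_tendsto_of_tendsto_of_le_of_le' tendsto_const_nhds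
    (hexp.comp (tendsto_div_sqrt_atTop h_pos h_anti hb hfin)) (Eventually.of_forall fun _ =>
      zero_le) ?_
  filter_upwards [self_mem_nhdsWithin] with t ht
  exact gaussianReal_Ioi_le_exp 1 (div_pos (h_pos t ht) (Real.sqrt_pos.2 ht)).le

lemma tendsto_kolmogorovIntegral_zero {b : ℝ} (hb : 0 < b)
    (hfin : kolmogorovIntegral h b < ∞) :
    Tendsto (fun n : ℕ => kolmogorovIntegral h (b / (n + 1))) atTop (𝓝 0) := by
  let μ : Measure ℝ := volume.withDensity fun t =>
    ENNReal.ofReal (h t / t ^ (3 / 2 : ℝ) * Real.exp (-(h t) ^ 2 / (2 * t)))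
  have hμ : ∀ s, kolmogorovIntegral h s = μ (Set.Ioc 0 s) := fun s =>
    (withDensity_apply _ measurableSet_Ioc).symm
  have hempty : ⋂ n : ℕ, Set.Ioc 0 (b / ((n : ℝ) + 1)) = ∅ := by
    ext t
    simp only [Set.mem_iInter, Set.mem_Ioc, Set.mem_empty_iff_false, iff_false, not_forall]
    rcases le_or_gt t 0 with ht | ht
    · exact ⟨0, fun h' => absurd h'.1 (not_lt.2 ht)⟩
    · obtain ⟨n, hn⟩ := exists_nat_one_div_lt (div_pos ht hb)
      refine ⟨n, fun h' => absurd h'.2 (not_le.2 ?_)⟩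
      rw [div_lt_div_iff₀ (by positivity) hb] at hn
      rw [div_lt_iff₀ (by positivity)]
      linarith
  simp only [hμ]
  rw [← measure_empty (μ := μ), ← hempty]
  refine tendsto_measure_iInter_atTop (fun n => measurableSet_Ioc.nullMeasurableSet) ?_ ⟨0, ?_⟩
  · intro m n hmn
    refine Set.Ioc_subset_Ioc_right ?_
    gcongr
  · rw [← hμ]
    simpa using hfin.ne

end Curve

/-! ### The crossing event before time b -/

lemma one_lt_supRatio_iff {Ω : Type*} {W : I → Ω → ℝ} {h : ℝ → ℝ} {b : ℝ} {ω : Ω} :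
    1 < supRatio W h b ω ↔ ∃ t : I, (0 < (t : ℝ) ∧ (t : ℝ) < b) ∧ 1 < W t ω / h t := by
  simp only [supRatio, lt_iSup_iff, exists_prop]
  refine exists_congr fun t => and_congr_right fun _ => ?_
  rw [← EReal.coe_one, EReal.coe_lt_coe_iff]

namespace IsWienerProcess

variable {Ω : Type*} [MeasurableSpace Ω] {P : Measure Ω} {W : I → Ω → ℝ} {h : ℝ → ℝ}

/-- The Kolmogorov integral bounds the probability that the path reaches the curve before `b`. -/
theorem measure_exists_one_le_div_le [IsFiniteMeasure P] (hW : IsWienerProcess W P)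
    (h_pos : ∀ t, 0 < t → 0 < h t) (h_mono : MonotoneOn h (Set.Ici 0))
    (h_anti : AntitoneOn (fun t => h t / √t) (Set.Ioi 0)) {b₀ : ℝ} (hb₀ : 0 < b₀)
    (hfin : kolmogorovIntegral h b₀ < ∞) {b : ℝ} (hb : 0 < b) :
    P {ω | ∃ t : I, (0 < (t : ℝ) ∧ (t : ℝ) < b) ∧ 1 ≤ W t ω / h t}
      ≤ kolmogorovIntegral h b := by
  have hβ0 : 0 < min b 1 := lt_min hb one_pos
  let β : I := ⟨min b 1, hβ0.le, min_le_right _ _⟩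
  let U : ℕ → Set Ω := fun n => {ω | ∃ t : I, β / ((n : ℝ) + 1) ≤ t ∧ t ≤ β ∧ h t ≤ W t ω}
  have hU : Monotone U := by
    rintro m n hmn ω ⟨t, hat, htb, hWt⟩
    refine ⟨t, le_trans ?_ hat, htb, hWt⟩
    have : (0 : ℝ) ≤ β := β.2.1
    gcongr
  have hPU : ∀ n, P (U n) ≤ kolmogorovIntegral h b := by
    intro n
    have hlim : Tendsto (fun a => 2 * gaussianReal 0 1 (Set.Ioi (h a / √a))
        + kolmogorovIntegral h b) (𝓝[>] 0) (𝓝 (2 * 0 + kolmogorovIntegral h b)) :=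
      (ENNReal.Tendsto.const_mul (tendsto_gaussianReal_div_sqrt h_pos h_anti hb₀ hfin)
        (Or.inr (by simp))).add tendsto_const_nhds
    rw [mul_zero, zero_add] at hlim
    refine ge_of_tendsto hlim ?_
    have hpos : (0 : ℝ) < β / ((n : ℝ) + 1) := div_pos hβ0 (by positivity)
    filter_upwards [Ioc_mem_nhdsGT hpos] with a ha
    have haβ : a ≤ β := ha.2.trans (div_le_self hβ0.le (by
      linarith [(Nat.cast_nonneg n : (0 : ℝ) ≤ n)]))
    have h1 := hW.measure_exists_ge_Icc_le h_pos h_mono h_anti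
      (a := ⟨a, ha.1.le, haβ.trans β.2.2⟩) (b := β) ha.1 haβ
    refine (measure_mono ?_).trans (h1.trans (add_le_add le_rfl ?_))
    · exact fun ω ⟨t, hat, htb, hWt⟩ => ⟨t, ha.2.trans hat, htb, hWt⟩
    · exact lintegral_mono_set (Set.Ioc_subset_Ioc ha.1.le (min_le_left _ _))
  calc P {ω | ∃ t : I, (0 < (t : ℝ) ∧ (t : ℝ) < b) ∧ 1 ≤ W t ω / h t}
      ≤ P (⋃ n, U n) := by
        refine measure_mono ?_
        rintro ω ⟨t, ⟨ht0, htb⟩, hWt⟩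
        obtain ⟨n, hn⟩ := exists_nat_one_div_lt ht0
        refine Set.mem_iUnion.2 ⟨n, t, le_trans ?_ hn.le, le_min htb.le t.2.2, ?_⟩
        · have := β.2.2
          gcongr
        · rwa [le_div_iff₀ (h_pos t ht0), one_mul] at hWt
    _ ≤ kolmogorovIntegral h b := by
        rw [hU.measure_iUnion]
        exact iSup_le hPU

lemma nullMeasurableSet_one_lt_supRatio (hW : IsWienerProcess W P)
    (h_pos : ∀ t, 0 < t → 0 < h t) (h_mono : MonotoneOn h (Set.Ici 0))
    (h_anti : AntitoneOn (fun t => h t / √t) (Set.Ioi 0)) (b : ℝ) :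
    NullMeasurableSet {ω | 1 < supRatio W h b ω} P := by
  have hc : ContinuousOn (fun t : I => h t) {t : I | 0 < (t : ℝ) ∧ (t : ℝ) < b} := fun t ht =>
    ((continuousAt_of_monotoneOn_of_antitoneOn h_mono h_anti ht.1).comp
      continuous_subtype_val.continuousAt).continuousWithinAt
  convert hW.nullMeasurableSet_exists_gt _ hc using 1
  ext ω
  simp only [Set.mem_ofPred_eq, one_lt_supRatio_iff]
  refine exists_congr fun t => and_congr_right fun ht => ?_
  rw [lt_div_iff₀ (h_pos t ht.1), one_mul]

end IsWienerProcess

/-! ### Counting a decreasing sequence of events -/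

/-- An initial segment of `ℕ` consists of the indices below its cardinality. -/
lemma IsLowerSet.coe_lt_encard_iff {S : Set ℕ} (hS : IsLowerSet S) {n : ℕ} :
    (n : ℕ∞) < S.encard ↔ n ∈ S := by
  constructor
  · intro h
    by_contra hn
    have hsub : S ⊆ Set.Iio n := fun m hm => by
      by_contra hmn
      exact hn (hS (not_lt.1 hmn) hm)
    have := Set.encard_le_encard hsub
    rw [Set.encard_eq_coe_toFinset_card (Set.Iio n)] at this
    simp only [Set.toFinset_Iio, Nat.card_Iio] at this
    exact absurd h (not_lt.2 this)
  · intro hn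
    have hsub : Set.Iic n ⊆ S := fun m hm => hS hm hn
    have := Set.encard_le_encard hsub
    rw [Set.encard_eq_coe_toFinset_card (Set.Iic n)] at this
    simp only [Set.toFinset_Iic, Nat.card_Iic] at this
    refine lt_of_lt_of_le ?_ this
    exact_mod_cast Nat.lt_succ_self n

lemma IsLowerSet.succ_le_encard_iff {S : Set ℕ} (hS : IsLowerSet S) {n : ℕ} :
    ((n + 1 : ℕ) : ℕ∞) ≤ S.encard ↔ n ∈ S := by
  rw [← hS.coe_lt_encard_iff]
  push_cast
  exact ENat.add_one_le_iff (ENat.natCast_ne_top n)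

/-- Markov's inequality for the antiderivative of the counting variable of a decreasing sequence
of events, of which no measurability is required. -/
lemma measure_le_inv_antiderivSum_mul {Ω : Type*} [MeasurableSpace Ω] {P : Measure Ω}
    {E : ℕ → Set Ω} (hE : Antitone E) {a : ℕ → ℝ≥0} (ha : ∀ n, 0 < a n) {c : ℕ → ℝ≥0∞}
    (hc : ∀ n, P (E n) ≤ c n) (k : ℕ) :
    P (E k) ≤ (antiderivSum a (k + 1 : ℕ))⁻¹ * ∑' n, a n * c n := by
  have hS : antiderivSum a (k + 1 : ℕ) * P (E k) ≤ ∑' n, a n * c n := by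
    rw [antiderivSum_natCast, Finset.sum_mul]
    refine le_trans (Finset.sum_le_sum fun n hn => ?_) (ENNReal.sum_le_tsum (Finset.range (k + 1)))
    have hnk : n ≤ k := Nat.lt_succ_iff.1 (Finset.mem_range.1 hn)
    gcongr
    exact (measure_mono (hE hnk)).trans (hc n)
  have h0 : antiderivSum a (k + 1 : ℕ) ≠ 0 := by
    rw [antiderivSum_natCast, Finset.sum_range_succ]
    have : (a k : ℝ≥0∞) ≠ 0 := ENNReal.coe_ne_zero.2 (ha k).ne'
    simp [this]
  have ht : antiderivSum a (k + 1 : ℕ) ≠ ∞ := by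
    rw [antiderivSum_natCast]
    exact ENNReal.sum_ne_top.2 fun n _ => ENNReal.coe_ne_top
  exact (ENNReal.mul_le_iff_le_inv h0 ht).1 hS

theorem theorem2 {Ω : Type*} [MeasurableSpace Ω] (P : Measure Ω) [IsProbabilityMeasure P]
    (W : I → Ω → ℝ) (hW : IsWienerProcess W P)
    (h : ℝ → ℝ) (h_zero : 0 ≤ h 0) (h_pos : ∀ t, 0 < t → 0 < h t)
    (h_mono : MonotoneOn h (Set.Ici 0))
    (h_anti : AntitoneOn (fun t => h t / √t) (Set.Ioi 0))
    (h_fin : ∃ L : ℝ≥0∞, L < ∞ ∧ Tendsto (kolmogorovIntegral h) (𝓝[>] 0) (𝓝 L)) :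
    (∀ᵐ ω ∂P, ∀ᶠ t : I in 𝓝[>] 0, W t ω / h t < 1) ∧
    ∀ b : ℕ → ℝ, (∀ n, 0 < b n) → Antitone b → Tendsto b atTop (𝓝 0) →
    ∀ a : ℕ → ℝ≥0, (∀ n, 0 < a n) →
      (∫⁻ ω, antiderivSum a (deviationCount W h b ω) ∂P
        = ∑' n, a n * P {ω | 1 < supRatio W h (b n) ω}) ∧
      (∫⁻ ω, antiderivSum a (deviationCount W h b ω) ∂P
        ≤ ∑' n, a n * kolmogorovIntegral h (b n)) ∧
      (∀ k : ℕ, 1 ≤ k →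
        P {ω | (k : ℕ∞) ≤ deviationCount W h b ω}
          ≤ (antiderivSum a k)⁻¹ * ∑' n, a n * kolmogorovIntegral h (b n)) ∧
      (∀ k : ℕ, 1 ≤ k →
        P {ω | (k : ℕ∞) ≤ hitCount W h b ω}
          ≤ (antiderivSum a k)⁻¹ * ∑' n, a n * kolmogorovIntegral h (b n)) := by

  obtain ⟨L, hL, hlim⟩ := h_fin
  obtain ⟨b₀, hfin, hb₀⟩ : ∃ b₀, kolmogorovIntegral h b₀ < ∞ ∧ 0 < b₀ :=
    ((hlim.eventually_lt_const hL).and self_mem_nhdsWithin).exists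
  have hhit : ∀ b : ℝ, 0 < b →
      P {ω | ∃ t : I, (0 < (t : ℝ) ∧ (t : ℝ) < b) ∧ 1 ≤ W t ω / h t} ≤ kolmogorovIntegral h b :=
    fun b hb => hW.measure_exists_one_le_div_le h_pos h_mono h_anti hb₀ hfin hb
  refine ⟨?_, fun b hb hbanti _ a ha => ?_⟩
  · refine nonpos_iff_eq_zero.1 (ge_of_tendsto' (tendsto_kolmogorovIntegral_zero hb₀ hfin)
      fun n => ?_)
    have hbn : 0 < b₀ / ((n : ℝ) + 1) := by positivity
    refine (measure_mono ?_).trans (hhit _ hbn)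
    intro ω hω
    by_contra hno
    refine hω ?_
    have h1 : ∀ᶠ t : I in 𝓝[>] 0, (t : ℝ) < b₀ / ((n : ℝ) + 1) :=
      ((continuous_subtype_val.tendsto (0 : I)).eventually_lt_const hbn).filter_mono
        nhdsWithin_le_nhds
    filter_upwards [h1, self_mem_nhdsWithin] with t ht ht0
    by_contra hge
    exact hno ⟨t, ⟨ht0, ht⟩, not_lt.1 hge⟩
  · have hdev : ∀ ω, IsLowerSet {n | 1 < supRatio W h (b n) ω} := by
      intro ω m n hnm hm
      simp only [Set.mem_ofPred_eq, one_lt_supRatio_iff] at hm ⊢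
      obtain ⟨t, ⟨ht0, htb⟩, hWt⟩ := hm
      exact ⟨t, ⟨ht0, htb.trans_le (hbanti hnm)⟩, hWt⟩
    have hlow : ∀ ω, IsLowerSet
        {n | ∃ t : I, (0 < (t : ℝ) ∧ (t : ℝ) < b n) ∧ 1 ≤ W t ω / h t} := by
      rintro ω m n hnm ⟨t, ⟨ht0, htb⟩, hWt⟩
      exact ⟨t, ⟨ht0, htb.trans_le (hbanti hnm)⟩, hWt⟩
    have hsup : ∀ n, P {ω | 1 < supRatio W h (b n) ω} ≤ kolmogorovIntegral h (b n) := by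
      intro n
      refine (measure_mono ?_).trans (hhit (b n) (hb n))
      intro ω hω
      obtain ⟨t, ht, hWt⟩ := one_lt_supRatio_iff.1 hω
      exact ⟨t, ht, hWt.le⟩
    have heq : ∫⁻ ω, antiderivSum a (deviationCount W h b ω) ∂P
        = ∑' n, a n * P {ω | 1 < supRatio W h (b n) ω} := by
      have hnull : ∀ n, NullMeasurableSet {ω | 1 < supRatio W h (b n) ω} P := fun n =>
        hW.nullMeasurableSet_one_lt_supRatio h_pos h_mono h_anti (b n)
      have hsum : ∀ ω, antiderivSum a (deviationCount W h b ω)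
          = ∑' n, {ω | 1 < supRatio W h (b n) ω}.indicator (fun _ => (a n : ℝ≥0∞)) ω := by
        intro ω
        refine tsum_congr fun n => ?_
        rw [Set.indicator_apply]
        exact if_congr (hdev ω).coe_lt_encard_iff rfl rfl
      simp_rw [hsum]
      rw [lintegral_tsum fun n => aemeasurable_const.indicator₀ (hnull n)]
      exact tsum_congr fun n => lintegral_indicator_const₀ (hnull n) _
    refine ⟨heq, ?_, fun k hk => ?_, fun k hk => ?_⟩
    · rw [heq]
      exact ENNReal.tsum_le_tsum fun n => mul_le_mul_right (hsup n) _
    · obtain ⟨m, rfl⟩ := Nat.exists_eq_add_of_le' hk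
      have hset : {ω | ((m + 1 : ℕ) : ℕ∞) ≤ deviationCount W h b ω}
          = {ω | 1 < supRatio W h (b m) ω} := by
        ext ω
        exact (hdev ω).succ_le_encard_iff
      rw [hset]
      exact measure_le_inv_antiderivSum_mul (E := fun n => {ω | 1 < supRatio W h (b n) ω})
        (fun i j hij ω hω => hdev ω hij hω) ha hsup m
    · obtain ⟨m, rfl⟩ := Nat.exists_eq_add_of_le' hk
      have hset : {ω | ((m + 1 : ℕ) : ℕ∞) ≤ hitCount W h b ω}
          = {ω | ∃ t : I, (0 < (t : ℝ) ∧ (t : ℝ) < b m) ∧ 1 ≤ W t ω / h t} := by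
        ext ω
        exact (hlow ω).succ_le_encard_iff
      rw [hset]
      exact measure_le_inv_antiderivSum_mul
        (E := fun n => {ω | ∃ t : I, (0 < (t : ℝ) ∧ (t : ℝ) < b n) ∧ 1 ≤ W t ω / h t})
        (fun i j hij ω hω => hlow ω hij hω) ha (fun n => hhit (b n) (hb n)) m
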